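/- **Words and natural colors.** Let $L \subseteq \Sigma^\omega$. For a finite word $u$, the residual language of $L$ over $u$ is $L|_u=\{w \mid uw\in L\}$. A word $w'$ arises from $w=w_0w_1\ldots$ by residual language invariant injections at positions in $J\subseteq\mathbb N$ if $w'=w_0\sigma_0w_1\sigma_1\ldots$ for finite words $\sigma_j$ with $\sigma_j=\epsilon$ for $j\notin J$ and $L|_{w_0\ldots w_j\sigma_j}=L|_{w_0\ldots w_j}$ for all $j$. Recursively, $w$ is *at home* in the color $i\in\mathbb N$ with respect to $L$ if there is an infinite set $J$ of positions such that every $w'$ arising from $w$ in this way is at home in a color smaller than $i$, or $w,w'\in L$ and $i$ is even, or $w,w'\notin L$ and $i$ is odd. The *natural color* of $w$ with respect to $L$ is the least color in which $w$ is at home. **Automata and chains.** Automata have finitely many states, read infinite words, are input-complete, and have their colors on transitions, where the color depends only on the source state and the letter. A run is accepting if the lowest color occurring infinitely often is even. A *co-Büchi automaton* uses only the colors $1$ (rejecting) and $2$ (accepting). An automaton $A$ with initial state $q_0$ is *history-deterministic* if there is a function $f$ from finite words to states such that a word $w$ is accepted by $A$ if and only if $q_0\,f(w_0)\,f(w_0w_1)\ldots$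 is an accepting run on $w$. The language represented by a chain $A_1,\ldots,A_n$ consists of the words that are rejected by $A_1$ or for which the highest $i$ such that $A_i$ accepts is even. A *COCOA* for $L$ is a sequence $A_1,\ldots,A_n$ of history-deterministic co-Büchi automata such that all words have natural colors of at most $n$ with respect to $L$ and each $A_i$ accepts exactly the words of natural color at least $i$. **The family.** For $k\in\mathbb N$ let $\Sigma=\{a_1,\ldots,a_{2k+1}\}\cup\{X_1,\ldots,X_k\}\cup\{Y_1,\ldots,Y_k\}$. Let $A^k_1$ be the deterministic co-Büchi automaton with a single state whose transitions are rejecting for $X_1,\ldots,X_k$ and accepting for all other letters. For $2\le i\le k+1$ let $A^k_i$ be the deterministic co-Büchi automaton with states $q_0$ (initial), $q_1$, $q_2$, in which $Y_{i-1}$ leads from $q_0$ to $q_1$, $X_{i-1}$ leads from $q_1$ to $q_2$, and all other transitions are self-loops. Its rejecting transitions are the two transitions between different states, all transitions for letters $X_m$, all those for letters $a_j$ with $j\ge 2k-2i+5$, and the one for $a_{2k-2i+4}$ in $q_2$; all others are accepting. Let $\mathcal C^k=(A^k_1,\ldots,A^k_{k+1})$, and let $L^k$ be the language represented by this chain. **Theorem.**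 For every $k\in\mathbb N$: 1. $\mathcal C^k$ has $3k+1$ states in total, $\mathcal L(A^k_1)\supsetneq\cdots\supsetneq\mathcal L(A^k_{k+1})$, and $\mathcal C^k$ is a COCOA for $L^k$. 2. The set $\hat L^k_0$ of the words of natural color $0$ with respect to $\Sigma^\omega\setminus L^k$ consists of exactly those words that contain $a_{2k+1}$ infinitely often and in which, for every $1\le m\le k$, the letter $Y_m$ occurs and $X_m$ does not occur after the first occurrence of $Y_m$. 3. $\hat L^k_0$ has at least $2^k$ residual languages. 4. In every COCOA for $\Sigma^\omega\setminus L^k$, the first automaton has at least $2^k$ states (and for $k\ge1$ every such COCOA has a first automaton). -/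

import Mathlib

open Filter

universe v

namespace Cocoa

/-! ### Infinite words, residual languages, natural colors -/

section Words

variable {α : Type*}

/-- The residual language `L|_u` of a language `L` of infinite words over a finite word `u`. -/
def residual (L : Set (Stream' α)) (u : List α) : Set (Stream' α) :=
  {w | u ++ₛ w ∈ L}

/-- `Extends L J w w'`: the word `w'` arises from `w = w₀ w₁ w₂ …` by injecting residual language
invariant (possibly empty) finite words `σ j` at positions `j ∈ J`, that is, directly after `w_j`;
so `w' = w₀ σ₀ w₁ σ₁ w₂ σ₂ …`, which is expressed by saying that every finite word
`w₀ σ₀ … w_{n-1} σ_{n-1}` is a prefix of `w'`. -/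
def Extends (L : Set (Stream' α)) (J : Set ℕ) (w w' : Stream' α) : Prop :=
  ∃ σ : ℕ → List α,
    (∀ j, j ∉ J → σ j = []) ∧
    (∀ j, residual L (w.take (j + 1) ++ σ j) = residual L (w.take (j + 1))) ∧
    ∀ n, ∃ v : Stream' α, w' = (List.range n).flatMap (fun j => w.get j :: σ j) ++ₛ v

/-- The word `w` is at home in the color `i` with respect to `L`. The sequence of injection
points is an infinite set of positions. -/
def AtHome (L : Set (Stream' α)) (i : ℕ) (w : Stream' α) : Prop :=
  ∃ J : Set ℕ, J.Infinite ∧ ∀ w', Extends L J w w' →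
    (∃ j : Fin i, AtHome L j.val w') ∨
    (w ∈ L ∧ w' ∈ L ∧ Even i) ∨ (w ∉ L ∧ w' ∉ L ∧ Odd i)
termination_by i
decreasing_by exact j.isLt

/-- `c` is the natural color of `w` with respect to `L`: the least color in which `w` is at
home. -/
def IsNaturalColor (L : Set (Stream' α)) (w : Stream' α) (c : ℕ) : Prop :=
  IsLeast {i | AtHome L i w} c

end Words

/-! ### Automata with transition-based acceptance -/

/-- Parity automata with transition-based acceptance: finitely many states, input-complete, and
the color of a transition depends only on its source state and its letter. -/
structure Automaton.{u, s} (α : Type u) : Type (max u (s + 1)) where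
  State : Type s
  finite_state : Finite State
  init : State
  trans : State → α → State → ℕ → Prop
  complete : ∀ q x, ∃ q' c, trans q x q' c
  color_unique : ∀ q x q₁ c₁ q₂ c₂, trans q x q₁ c₁ → trans q x q₂ c₂ → c₁ = c₂

namespace Automaton

variable {α : Type*}

/-- The size of an automaton: its number of states. -/
noncomputable def size (A : Automaton α) : ℕ := Nat.card A.State

/-- `π` is a run on `w` from the initial state, with color sequence `ρ`. -/
def IsRun (A : Automaton α) (w : Stream' α) (π : ℕ → A.State) (ρ : ℕ → ℕ) : Prop :=
  π 0 = A.init ∧ ∀ i, A.trans (π i) (w.get i) (π (i + 1)) (ρ i)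

/-- `c` is the dominating color of `ρ`: the lowest color occurring infinitely often. -/
def IsDominating (ρ : ℕ → ℕ) (c : ℕ) : Prop :=
  IsLeast {d | ∃ᶠ i in atTop, ρ i = d} c

/-- `π` is an accepting run on `w`. -/
def IsAcceptingRun (A : Automaton α) (w : Stream' α) (π : ℕ → A.State) : Prop :=
  ∃ ρ c, A.IsRun w π ρ ∧ IsDominating ρ c ∧ Even c

/-- The language of the automaton. -/
def language (A : Automaton α) : Set (Stream' α) :=
  {w | ∃ π, A.IsAcceptingRun w π}

/-- Co-Büchi automata: only the colors `1` (rejecting) and `2` (accepting) occur. -/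
def IsCoBuchi (A : Automaton α) : Prop :=
  ∀ q x q' c, A.trans q x q' c → c = 1 ∨ c = 2

/-- The sequence of states `q₀, f(w₀), f(w₀ w₁), …` that the advice function `f` yields on `w`. -/
def adviceRun (A : Automaton α) (f : List α → A.State) (w : Stream' α) : ℕ → A.State
  | 0 => A.init
  | n + 1 => f (w.take (n + 1))

/-- History-determinism. -/
def IsHistoryDeterministic (A : Automaton α) : Prop :=
  ∃ f : List α → A.State, ∀ w,
    w ∈ A.language ↔ A.IsAcceptingRun w (A.adviceRun f w)

/-- The deterministic automaton with the given transition and color functions. -/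
def ofFun {α Q : Type*} [Finite Q] (q₀ : Q) (next : Q → α → Q) (color : Q → α → ℕ) :
    Automaton α where
  State := Q
  finite_state := inferInstance
  init := q₀
  trans q x q' c := q' = next q x ∧ c = color q x
  complete q x := ⟨_, _, rfl, rfl⟩
  color_unique := by
    rintro q x q₁ c₁ q₂ c₂ ⟨_, h₁⟩ ⟨_, h₂⟩
    rw [h₁, h₂]

end Automaton

/-! ### Chains of co-Büchi automata -/

section Chains

variable {α : Type*} {n : ℕ}

/-- The language represented by a chain `L₁, …, Lₙ` (where `Lᵢ` is `Ls` at index `i - 1`): a word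
belongs to it if it is not in `L₁` or the highest `i` such that it is in `Lᵢ` is even. -/
def chainLanguage (Ls : Fin n → Set (Stream' α)) : Set (Stream' α) :=
  {w | (∀ h : 0 < n, w ∉ Ls ⟨0, h⟩) ∨
    ∃ i : Fin n, w ∈ Ls i ∧ (∀ j, i < j → w ∉ Ls j) ∧ Even (i.val + 1)}

/-- `A₁, …, Aₙ` (where `Aᵢ` is `C` at index `i - 1`) is a COCOA for `L`: a sequence of
history-deterministic co-Büchi automata such that every word has a natural color with respect to
`L`, this color is at most `n`, and `Aᵢ` accepts exactly the words of natural color at least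
`i`. -/
def IsCOCOA (L : Set (Stream' α)) (C : Fin n → Automaton α) : Prop :=
  (∀ i, (C i).IsCoBuchi ∧ (C i).IsHistoryDeterministic) ∧
  ∀ w, ∃ c, IsNaturalColor L w c ∧ c ≤ n ∧ ∀ i : Fin n, w ∈ (C i).language ↔ i.val + 1 ≤ c

end Chains

/-! ### The family of chains -/

/-- The alphabet `{a₁, …, a_{2k+1}} ∪ {X₁, …, X_k} ∪ {Y₁, …, Y_k}`. -/
inductive Letter (k : ℕ) : Type
  | a (j : Set.Icc 1 (2 * k + 1))
  | X (m : Set.Icc 1 k)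
  | Y (m : Set.Icc 1 k)

/-- The automaton `A₁`: a single state, rejecting exactly at the letters `X₁, …, X_k`. -/
def firstAutomaton (k : ℕ) : Automaton (Letter k) :=
  Automaton.ofFun () (fun _ _ => ()) fun _ x =>
    match x with
    | .X _ => 1
    | _ => 2

/-- Transitions of `Aᵢ` for `i ≥ 2`: from state `0` to state `1` under `Y_{i-1}`, from state `1` to
state `2` under `X_{i-1}`, and self-loops otherwise. -/
def laterNext (k i : ℕ) : Fin 3 → Letter k → Fin 3
  | 0, .Y m => if m.val + 1 = i then 1 else 0
  | 1, .X m => if m.val + 1 = i then 2 else 1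
  | q, _ => q

/-- Colors of `Aᵢ` for `i ≥ 2`. In the states `0` and `1`, the letters `a_j` with
`j ≤ 2k - 2i + 4` are accepting, in state `2` only those with `j ≤ 2k - 2i + 3`. The letters
`X_m` are rejecting. The letters `Y_m` are accepting, except for the transition from `0` to `1`. -/
def laterColor (k i : ℕ) : Fin 3 → Letter k → ℕ
  | 2, .a j => if j.val + 2 * i ≤ 2 * k + 3 then 2 else 1
  | _, .a j => if j.val + 2 * i ≤ 2 * k + 4 then 2 else 1
  | _, .X _ => 1
  | 0, .Y m => if m.val + 1 = i then 1 else 2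
  | _, .Y _ => 2

/-- The automaton `Aᵢ` for `2 ≤ i ≤ k + 1`. -/
def laterAutomaton (k i : ℕ) : Automaton (Letter k) :=
  Automaton.ofFun (0 : Fin 3) (laterNext k i) (laterColor k i)

/-- The chain `A₁, …, A_{k+1}`, with `Aᵢ` at index `i - 1`. -/
def chain (k : ℕ) (i : Fin (k + 1)) : Automaton (Letter k) :=
  if i.val = 0 then firstAutomaton k else laterAutomaton k (i.val + 1)

/-- The language `L^k` represented by the chain. -/
def chainLang (k : ℕ) : Set (Stream' (Letter k)) :=
  chainLanguage fun i => (chain k i).language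

/-- The words of natural color `0` with respect to the complement of `L^k`. -/
def complZero (k : ℕ) : Set (Stream' (Letter k)) :=
  {w | IsNaturalColor (chainLang k)ᶜ w 0}

end Cocoa

namespace Cocoa

/-! Give `a_j` height `j`, every `X_m` height `2k+2` and every `Y_m` height `0`. Whether an
automaton of the chain accepts a word depends only on the largest height `t` occurring infinitely
often and on the state in which that automaton settles: the automaton at index `i` accepts iff `t +
2i + p ≤ 2k+2`, where `p` is `1` for `i = 0` or limit state `2`, and `0` otherwise. The number of
accepting automata is the `color` of the word. Two finite words have the same residual of `L^k` iff
they put every three-state automaton into the same state (`residual_chainLang_eq_iff`). Injections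
therefore preserve limit states and can only raise `t`, so they never raise the color; and while the
color is at least `2`, a suitable letter `a_j` lowers it by exactly one. Hence `color` is the
natural color (`isNaturalColor_color`). Complementation keeps the admissible injections. A word has
natural color `0` for the complement iff, for some `J`, all its extensions have odd color. If some
limit state is not `1`, the matching `X_i` is injectable forever and forces color `0`. If all are
`1`, no `X_m` can recur, and the color stays odd exactly when it is pinned to `1` by `t = 2k+1`
(`mem_complZero_iff`). This language must remember which `Y_m` have occurred, which gives `2^k`
residuals. The first automaton of a COCOA for the complement accepts its complement, and the advice
of a history-deterministic automaton must separate residuals (`residual_eq_of_advice_eq`). -/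

theorem take_length_append_stream {α : Type*} (u : List α) (v : Stream' α) :
    (u ++ₛ v).take u.length = u := by
  rw [Stream'.take_append_of_le_length (h := le_rfl), List.take_length]

/-! ### Deterministic co-Büchi acceptance, and residuals under advice functions -/

namespace Automaton

theorem exists_isDominating_even_iff {ρ : ℕ → ℕ} (hρ : ∀ n, ρ n = 1 ∨ ρ n = 2) :
    (∃ c, IsDominating ρ c ∧ Even c) ↔ ∀ᶠ n in atTop, ρ n = 2 := by
  constructor
  · rintro ⟨c, ⟨hc, hmin⟩, he⟩
    have h1 : ¬ ∃ᶠ n in atTop, ρ n = 1 := fun h => by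
      have hle := hmin h
      obtain ⟨n, hn⟩ := Frequently.exists hc
      rcases hρ n with h' | h' <;> rw [hn] at h' <;> subst h'
      · simp at he
      · omega
    rw [not_frequently] at h1
    filter_upwards [h1] with n hn
    exact (hρ n).resolve_left hn
  · intro h
    refine ⟨2, ⟨h.frequently, fun d hd => ?_⟩, even_two⟩
    obtain ⟨n, hn, hn'⟩ := (Frequently.and_eventually hd h).exists
    omega

theorem foldl_take_succ {α Q : Type*} {q₀ : Q} {next : Q → α → Q} (w : Stream' α) (n : ℕ) :
    (w.take (n + 1)).foldl next q₀ = next ((w.take n).foldl next q₀) (w.get n) := by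
  rw [Stream'.take_succ', List.foldl_append]
  rfl

variable {α Q : Type*} [Finite Q] {q₀ : Q} {next : Q → α → Q} {color : Q → α → ℕ}

theorem ofFun_isRun_iff {w : Stream' α} {π : ℕ → Q} {ρ : ℕ → ℕ} :
    (ofFun q₀ next color).IsRun w π ρ ↔ (∀ n, π n = (w.take n).foldl next q₀) ∧
      ∀ n, ρ n = color ((w.take n).foldl next q₀) (w.get n) := by
  constructor
  · rintro ⟨h0, h⟩
    have hπ : ∀ n, π n = (w.take n).foldl next q₀ := by
      intro n
      induction n with
      | zero => exact h0
      | succ n ih => rw [foldl_take_succ, ← ih]; exact (h n).1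
    exact ⟨hπ, fun n => by rw [← hπ]; exact (h n).2⟩
  · rintro ⟨hπ, hρ⟩
    refine ⟨hπ 0, fun n => ⟨?_, ?_⟩⟩
    · rw [hπ, hπ, foldl_take_succ]
    · rw [hρ, hπ]

theorem ofFun_isAcceptingRun_iff (hc : ∀ q x, color q x = 1 ∨ color q x = 2)
    {w : Stream' α} {π : ℕ → Q} :
    (ofFun q₀ next color).IsAcceptingRun w π ↔ (∀ n, π n = (w.take n).foldl next q₀) ∧
      ∀ᶠ n in atTop, color ((w.take n).foldl next q₀) (w.get n) = 2 := by
  rw [← exists_isDominating_even_iff fun n => hc _ _]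
  constructor
  · rintro ⟨ρ, c, hr, hd⟩
    obtain ⟨hπ, hρ⟩ := ofFun_isRun_iff.1 hr
    exact ⟨hπ, c, (funext hρ : ρ = _) ▸ hd⟩
  · rintro ⟨hπ, c, hd⟩
    exact ⟨_, c, ofFun_isRun_iff.2 ⟨hπ, fun n => rfl⟩, hd⟩

theorem mem_ofFun_language_iff (hc : ∀ q x, color q x = 1 ∨ color q x = 2) {w : Stream' α} :
    w ∈ (ofFun q₀ next color).language ↔
      ∀ᶠ n in atTop, color ((w.take n).foldl next q₀) (w.get n) = 2 := by
  constructor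
  · rintro ⟨π, h⟩
    exact ((ofFun_isAcceptingRun_iff hc).1 h).2
  · exact fun h => ⟨_, (ofFun_isAcceptingRun_iff hc).2 ⟨fun n => rfl, h⟩⟩

theorem ofFun_isCoBuchi (hc : ∀ q x, color q x = 1 ∨ color q x = 2) :
    (ofFun q₀ next color).IsCoBuchi := by
  rintro q x q' c ⟨_, rfl⟩
  exact hc q x

theorem ofFun_isHistoryDeterministic (hc : ∀ q x, color q x = 1 ∨ color q x = 2) :
    (ofFun q₀ next color).IsHistoryDeterministic := by
  refine ⟨fun u => u.foldl next q₀, fun w => ?_⟩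
  have h := ofFun_isAcceptingRun_iff (q₀ := q₀) (next := next) hc (w := w)
    (π := adviceRun (ofFun q₀ next color) (fun u => u.foldl next q₀) w)
  exact (mem_ofFun_language_iff hc).trans
    ((and_iff_right fun n => by cases n <;> rfl).symm.trans h.symm)

/-- An advice function sends finite words with nonempty residuals to states that determine the
residual language. -/
theorem residual_eq_of_advice_eq {A : Automaton α} {f : List α → A.State}
    (hf : ∀ w, w ∈ A.language ↔ A.IsAcceptingRun w (A.adviceRun f w)) {u u' : List α}
    (hu : u ≠ []) (hu' : u' ≠ [])
    (hne' : (residual A.language u').Nonempty)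
    (h : f u = f u') : residual A.language u ⊆ residual A.language u' := by
  intro v hv
  -- Advice yields a genuine run only on accepted words; `v₀` certifies that the advised path along
  -- `u'` really leads to `f u'`.
  obtain ⟨v₀, hv₀⟩ := hne'
  obtain ⟨ρ, c, ⟨-, hr⟩, hd, he⟩ := (hf _).1 hv
  obtain ⟨ρ₀, -, ⟨-, hr₀⟩, -⟩ := (hf _).1 hv₀
  have key : ∀ (x : List α) (s : Stream' α), x ≠ [] → A.adviceRun f (x ++ₛ s) x.length = f x := by
    intro x s hx
    obtain ⟨n, hn⟩ := Nat.exists_eq_succ_of_ne_zero (List.length_pos_of_ne_nil hx).ne'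
    rw [hn, adviceRun, ← Nat.succ_eq_add_one, ← hn, take_length_append_stream]
  set l := u.length with hl
  set l' := u'.length with hl'
  -- Splice two runs at the common state `f u = f u'`: the advised path along `u'`, then the tail on
  -- `v` of the accepting run on `u ++ₛ v`. The color sequences agree up to finite prefixes and a
  -- shift, so the dominating color survives.
  refine ⟨fun n => if n ≤ l' then A.adviceRun f (u' ++ₛ v₀) n
    else A.adviceRun f (u ++ₛ v) (n - l' + l),
    fun n => if n < l' then ρ₀ n else ρ (n - l' + l), c, ⟨by simp [adviceRun], fun n => ?_⟩, ?_, he⟩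
  · rcases lt_trichotomy n l' with hn | rfl | hn
    · have := hr₀ n
      simp only [hn, hn.le, Nat.succ_le_of_lt hn, if_true]
      rwa [Stream'.get_append_left _ _ _ hn] at this ⊢
    · have := hr l
      simp only [le_refl, if_true, lt_irrefl, if_false, Nat.not_succ_le_self, hl', key u' v₀ hu']
      rw [hl, key u v hu, ← hl, h] at this
      have e : l' + 1 - l' + l = l + 1 := by omega
      rw [e, Nat.sub_self, zero_add]
      have e1 := Stream'.get_append_right 0 u v
      have e2 := Stream'.get_append_right 0 u' v
      simp only [add_zero] at e1 e2
      rw [e2]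
      rwa [e1] at this
    · have := hr (n - l' + l)
      have h1 : ¬ n ≤ l' := by omega
      have h2 : ¬ n < l' := by omega
      have h3 : ¬ n + 1 ≤ l' := by omega
      simp only [h1, h2, h3, if_false]
      have e : n + 1 - l' + l = n - l' + l + 1 := by omega
      rw [e]
      have e1 := Stream'.get_append_right (n - l') u v
      have e2 := Stream'.get_append_right (n - l') u' v
      rw [show u'.length + (n - l') = n by omega] at e2
      rw [show u.length + (n - l') = n - l' + l by omega] at e1
      rw [e2]
      rwa [e1] at this
  · have : {d | ∃ᶠ i in atTop, (if i < l' then ρ₀ i else ρ (i - l' + l)) = d} =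
        {d | ∃ᶠ i in atTop, ρ i = d} := by
      ext d
      simp only [Set.mem_ofPred_eq, frequently_atTop]
      constructor
      · intro H N
        obtain ⟨b, hb, hb'⟩ := H (N + l')
        rw [if_neg (by omega)] at hb'
        exact ⟨_, by omega, hb'⟩
      · intro H N
        obtain ⟨b, hb, hb'⟩ := H (N + l)
        refine ⟨b - l + l', by omega, ?_⟩
        rw [if_neg (by omega), show b - l + l' - l' + l = b by omega, hb']
    unfold IsDominating
    rwa [this]

end Automaton

/-! ### Words arising by injections -/

section Injections

variable {α : Type*}

/-- The finite word `w₀ σ₀ … w_{n-1} σ_{n-1}`. -/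
def interleave (w : Stream' α) (σ : ℕ → List α) (n : ℕ) : List α :=
  (List.range n).flatMap fun j => w.get j :: σ j

theorem interleave_succ (w : Stream' α) (σ : ℕ → List α) (n : ℕ) :
    interleave w σ (n + 1) = interleave w σ n ++ w.get n :: σ n := by
  simp [interleave, List.range_succ]

theorem exists_interleave_add (w : Stream' α) (σ : ℕ → List α) (N n : ℕ) :
    ∃ v, interleave w σ (N + n) = interleave w σ N ++ v ∧
      ∀ x ∈ v, ∃ j ≥ N, x ∈ w.get j :: σ j := by
  induction n with
  | zero => exact ⟨[], by simp, by simp⟩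
  | succ n ih =>
    obtain ⟨v, hv, h⟩ := ih
    refine ⟨v ++ w.get (N + n) :: σ (N + n), ?_, fun x hx => ?_⟩
    · rw [← add_assoc, interleave_succ, hv, List.append_assoc]
    · rcases List.mem_append.1 hx with hx | hx
      · exact h x hx
      · exact ⟨_, by omega, hx⟩

theorem le_length_interleave (w : Stream' α) (σ : ℕ → List α) (n : ℕ) :
    n ≤ (interleave w σ n).length := by
  induction n with
  | zero => simp
  | succ n ih => rw [interleave_succ]; simp; omega

/-- The infinite word `w₀ σ₀ w₁ σ₁ …`. -/
def inject (w : Stream' α) (σ : ℕ → List α) : Stream' α :=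
  fun n => (interleave w σ (n + 1))[n]'(le_length_interleave w σ (n + 1))

theorem inject_get {w : Stream' α} {σ : ℕ → List α} {n N : ℕ}
    (h : n < (interleave w σ N).length) : (inject w σ).get n = (interleave w σ N)[n] := by
  change (interleave w σ (n + 1))[n]'(le_length_interleave w σ (n + 1)) = _
  have h' := le_length_interleave w σ (n + 1)
  rcases le_total N (n + 1) with hN | hN
  · obtain ⟨v, hv, -⟩ := exists_interleave_add w σ N (n + 1 - N)
    rw [Nat.add_sub_cancel' hN] at hv
    simp [hv, List.getElem_append_left h]
  · obtain ⟨v, hv, -⟩ := exists_interleave_add w σ (n + 1) (N - (n + 1))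
    rw [Nat.add_sub_cancel' hN] at hv
    simp only [hv]
    rw [List.getElem_append_left]

theorem inject_prefix (w : Stream' α) (σ : ℕ → List α) (N : ℕ) :
    ∃ v, inject w σ = interleave w σ N ++ₛ v := by
  refine ⟨(inject w σ).drop (interleave w σ N).length, ?_⟩
  have : (inject w σ).take (interleave w σ N).length = interleave w σ N := by
    refine List.ext_getElem (by simp) fun n h1 h2 => ?_
    rw [← inject_get h2]
    simp
  conv_rhs => enter [1]; rw [← this]
  rw [Stream'.append_take_drop]

theorem inject_eventually {w : Stream' α} {σ : ℕ → List α} {P : α → Prop}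
    (h : ∀ᶠ j in atTop, ∀ x ∈ w.get j :: σ j, P x) : ∀ᶠ n in atTop, P ((inject w σ).get n) := by
  obtain ⟨N, hN⟩ := eventually_atTop.1 h
  filter_upwards [eventually_ge_atTop (interleave w σ N).length] with n hn
  obtain ⟨v, hv, hv'⟩ := exists_interleave_add w σ N (n + 1)
  have hlen := le_length_interleave w σ (N + (n + 1))
  have hlt : n < (interleave w σ (N + (n + 1))).length := by omega
  obtain ⟨j, hj, hx⟩ : ∃ j ≥ N, (inject w σ).get n ∈ w.get j :: σ j := by
    apply hv'
    rw [inject_get hlt]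
    simp only [hv]
    rw [List.getElem_append_right hn]
    exact List.getElem_mem _
  exact hN j hj _ hx

theorem inject_frequently {w : Stream' α} {σ : ℕ → List α} {x : α}
    (h : ∃ᶠ j in atTop, σ j = [x]) : ∃ᶠ n in atTop, (inject w σ).get n = x := by
  rw [frequently_atTop] at h ⊢
  intro N
  obtain ⟨j, hj, hx⟩ := h N
  have h1 := le_length_interleave w σ j
  refine ⟨(interleave w σ j).length + 1, by omega, ?_⟩
  have h2 := interleave_succ w σ j
  rw [hx] at h2
  have h3 : (interleave w σ j).length + 1 < (interleave w σ (j + 1)).length := by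
    rw [h2]; simp
  rw [inject_get h3]
  simp [h2]

theorem extends_inject {L : Set (Stream' α)} {J : Set ℕ} {w : Stream' α} {σ : ℕ → List α}
    (hJ : ∀ j, j ∉ J → σ j = [])
    (h : ∀ j, residual L (w.take (j + 1) ++ σ j) = residual L (w.take (j + 1))) :
    Extends L J w (inject w σ) :=
  ⟨σ, hJ, h, inject_prefix w σ⟩

theorem extends_refl (L : Set (Stream' α)) (J : Set ℕ) (w : Stream' α) : Extends L J w w := by
  refine ⟨fun _ => [], fun _ _ => rfl, by simp, fun n => ⟨w.drop n, ?_⟩⟩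
  have : (List.range n).flatMap (fun j => [w.get j]) = w.take n := by
    induction n with
    | zero => rfl
    | succ n ih => rw [List.range_succ, List.flatMap_append, ih, Stream'.take_succ']; simp
  rw [this, Stream'.append_take_drop]

theorem residual_append (L : Set (Stream' α)) (u v : List α) :
    residual L (u ++ v) = residual (residual L u) v := by
  ext w
  simp [residual, Stream'.append_append_stream]

theorem residual_compl_eq_iff {L : Set (Stream' α)} {u v : List α} :
    residual Lᶜ u = residual Lᶜ v ↔ residual L u = residual L v :=
  compl_inj_iff (x := residual L u) (y := residual L v)

theorem extends_compl_iff {L : Set (Stream' α)} {J : Set ℕ} {w w' : Stream' α} :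
    Extends Lᶜ J w w' ↔ Extends L J w w' := by
  simp only [Extends, residual_compl_eq_iff]

/-- The letters of `w` occur in order in every word arising from `w` by injections, and any
state that is determined by a residual-invariant fold is preserved. -/
theorem Extends.exists_strictMono {L : Set (Stream' α)} {J : Set ℕ} {w w' : Stream' α}
    (h : Extends L J w w') : ∃ p : ℕ → ℕ, StrictMono p ∧ (∀ n, w'.get (p n) = w.get n) ∧
      ∀ {Q : Type} (next : Q → α → Q) (q₀ : Q),
        (∀ u v, residual L u = residual L v → u.foldl next q₀ = v.foldl next q₀) →
        ∀ n, (w'.take (p n)).foldl next q₀ = (w.take n).foldl next q₀ := by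
  obtain ⟨σ, -, hr, hp⟩ := h
  change ∀ n, ∃ v, w' = interleave w σ n ++ₛ v at hp
  have htake : ∀ n, w'.take (interleave w σ n).length = interleave w σ n := by
    intro n
    obtain ⟨v, hv⟩ := hp n
    rw [hv, take_length_append_stream]
  -- The letter `w_n` lands directly behind the first `n` letters and their injected words.
  refine ⟨fun n => (interleave w σ n).length, strictMono_nat_of_lt_succ fun n => ?_,
    fun n => ?_, fun {Q} next q₀ hq n => ?_⟩
  · rw [interleave_succ]; simp
  · obtain ⟨v, hv⟩ := hp (n + 1)
    rw [hv, interleave_succ, Stream'.append_append_stream]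
    simp
  · simp only [htake]
    induction n with
    | zero => rfl
    | succ n ih =>
      rw [← hq _ _ (hr n), interleave_succ, Stream'.take_succ', List.foldl_append, ih]
      simp [List.foldl_append, Automaton.foldl_take_succ]

end Injections

/-! ### Heights of letters and their limit superior -/

variable {k : ℕ}

/-- The height of a letter: `j` for `a_j`, above all of these for `X_m`, and `0` for `Y_m`. -/
def height : Letter k → ℕ
  | .a j => j.val
  | .X _ => 2 * k + 2
  | .Y _ => 0

theorem height_le (x : Letter k) : height x ≤ 2 * k + 2 := by
  cases x with
  | a j => have := j.2.2; simp only [height]; omega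
  | _ => simp [height]

/-- The largest height occurring infinitely often. -/
noncomputable def topHeight (w : Stream' (Letter k)) : ℕ :=
  sInf {t | ∀ᶠ n in atTop, height (w.get n) ≤ t}

theorem topHeight_le_iff {w : Stream' (Letter k)} {t : ℕ} :
    topHeight w ≤ t ↔ ∀ᶠ n in atTop, height (w.get n) ≤ t := by
  have hne : {t | ∀ᶠ n in atTop, height (w.get n) ≤ t}.Nonempty :=
    ⟨2 * k + 2, Eventually.of_forall fun n => height_le _⟩
  refine ⟨fun h => ?_, fun h => Nat.sInf_le h⟩
  have := Nat.sInf_mem hne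
  exact Eventually.mono this fun n hn => hn.trans h

theorem eventually_height_add_le_iff {w : Stream' (Letter k)} {c t : ℕ} :
    (∀ᶠ n in atTop, height (w.get n) + c ≤ t) ↔ topHeight w + c ≤ t := by
  constructor
  · intro h
    -- A single instance shows `c ≤ t`, so the truncated subtraction `t - c` is harmless.
    obtain ⟨n, hn⟩ := h.exists
    have : topHeight w ≤ t - c := topHeight_le_iff.2 (h.mono fun n hn => by omega)
    omega
  · intro h
    exact (topHeight_le_iff.1 (le_refl (topHeight w))).mono fun n hn => by omega

theorem height_le_topHeight {w : Stream' (Letter k)} {x : Letter k}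
    (h : ∃ᶠ n in atTop, w.get n = x) : height x ≤ topHeight w := by
  obtain ⟨n, hn, hn'⟩ := (h.and_eventually (topHeight_le_iff.1 le_rfl)).exists
  exact hn ▸ hn'

theorem topHeight_mono {w w' : Stream' (Letter k)} {p : ℕ → ℕ} (hp : StrictMono p)
    (h : ∀ n, w'.get (p n) = w.get n) : topHeight w ≤ topHeight w' := by
  rw [topHeight_le_iff]
  filter_upwards [hp.tendsto_atTop.eventually (topHeight_le_iff.1 (le_refl (topHeight w')))]
    with n hn
  rwa [h] at hn

theorem topHeight_append (u : List (Letter k)) (w : Stream' (Letter k)) :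
    topHeight (u ++ₛ w) = topHeight w := by
  refine eq_of_forall_ge_iff fun t => ?_
  rw [topHeight_le_iff, topHeight_le_iff]
  conv_lhs => rw [← map_add_atTop_eq_nat u.length]
  simp only [eventually_map, add_comm _ u.length, Stream'.get_append_right]

/-! ### Limit states of the three-state automata -/

/-- The state of `A_{i+1}` after reading a finite word. -/
def track (i : ℕ) (u : List (Letter k)) : Fin 3 :=
  u.foldl (laterNext k (i + 1)) 0

theorem track_take_succ (i n : ℕ) (w : Stream' (Letter k)) :
    track i (w.take (n + 1)) = laterNext k (i + 1) (track i (w.take n)) (w.get n) :=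
  Automaton.foldl_take_succ w n

theorem track_append (i : ℕ) (u v : List (Letter k)) :
    track i (u ++ v) = v.foldl (laterNext k (i + 1)) (track i u) :=
  List.foldl_append

theorem le_laterNext (i : ℕ) (q : Fin 3) (x : Letter k) : q ≤ laterNext k i q x := by
  fin_cases q <;> cases x <;> simp [laterNext] <;> split_ifs <;> decide

theorem track_monotone (i : ℕ) (w : Stream' (Letter k)) :
    Monotone fun n => track i (w.take n) :=
  monotone_nat_of_le_succ fun n => by
    rw [track_take_succ]
    exact le_laterNext _ _ _

theorem exists_eventually_track_eq (i : ℕ) (w : Stream' (Letter k)) :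
    ∃ q, ∀ᶠ n in atTop, track i (w.take n) = q := by
  obtain ⟨n, hn⟩ := WellFoundedGT.monotone_chain_condition ⟨_, track_monotone i w⟩
  exact ⟨_, eventually_atTop.2 ⟨n, fun m hm => (hn m hm).symm⟩⟩

/-- The state in which `A_{i+1}` eventually remains when reading `w`. -/
noncomputable def finalState (i : ℕ) (w : Stream' (Letter k)) : Fin 3 :=
  (exists_eventually_track_eq i w).choose

theorem eventually_track_eq (i : ℕ) (w : Stream' (Letter k)) :
    ∀ᶠ n in atTop, track i (w.take n) = finalState i w :=
  (exists_eventually_track_eq i w).choose_spec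

theorem finalState_eq {i : ℕ} {w : Stream' (Letter k)} {q : Fin 3}
    (h : ∃ᶠ n in atTop, track i (w.take n) = q) : finalState i w = q := by
  obtain ⟨n, hn, hn'⟩ := (h.and_eventually (eventually_track_eq i w)).exists
  exact hn'.symm.trans hn

theorem track_le_finalState (i n : ℕ) (w : Stream' (Letter k)) :
    track i (w.take n) ≤ finalState i w := by
  obtain ⟨m, hm, hm'⟩ := ((eventually_track_eq i w).and (eventually_ge_atTop n)).exists
  exact hm ▸ track_monotone i w hm'

theorem finalState_append {i : ℕ} {u u' : List (Letter k)} (h : track i u = track i u')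
    (w : Stream' (Letter k)) : finalState i (u ++ₛ w) = finalState i (u' ++ₛ w) := by
  have key : ∀ (x : List (Letter k)) n, track i ((x ++ₛ w).take (x.length + n)) =
      (w.take n).foldl (laterNext k (i + 1)) (track i x) := fun x n => by
    rw [← Stream'.append_take, track_append]
  apply finalState_eq
  refine (tendsto_add_atTop_nat u.length).frequently
    (p := fun n => track i ((u ++ₛ w).take n) = finalState i (u' ++ₛ w)) ?_
  refine Eventually.frequently ?_
  filter_upwards [(tendsto_add_atTop_nat u'.length).eventually
    (eventually_track_eq i (u' ++ₛ w))] with n hn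
  rw [add_comm, key] at hn ⊢
  rw [h, hn]

/-! ### Acceptance as a threshold on the top height -/

theorem laterColor_eq (i : ℕ) (q : Fin 3) (x : Letter k) :
    laterColor k i q x = 1 ∨ laterColor k i q x = 2 := by
  fin_cases q <;> cases x <;> simp [laterColor] <;> grind

/-- On self-loops the coloring is a pure height test: `X_m` always fails since `i ≥ 1`, and `Y_m`
always passes since `i ≤ k`. Transitions between different states do not fit this pattern, but each
run takes only finitely many of them. -/
theorem laterColor_eq_two_iff {i : ℕ} (hi : 1 ≤ i) (hik : i ≤ k) {q : Fin 3} {x : Letter k}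
    (hq : laterNext k (i + 1) q x = q) :
    laterColor k (i + 1) q x = 2 ↔
      height x + (2 * i + if q = 2 then 1 else 0) ≤ 2 * k + 2 := by
  fin_cases q <;> cases x <;> simp [laterNext, laterColor, height] at hq ⊢ <;> grind

/-- `1` if the threshold of the `i`-th automaton is lowered (from state `2` on). -/
noncomputable def penalty (i : ℕ) (w : Stream' (Letter k)) : ℕ :=
  open Classical in if i = 0 ∨ k < i ∨ finalState i w = 2 then 1 else 0

theorem penalty_le (i : ℕ) (w : Stream' (Letter k)) : penalty i w ≤ 1 := by
  unfold penalty; split_ifs <;> simp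

theorem penalty_zero (w : Stream' (Letter k)) : penalty 0 w = 1 := by simp [penalty]

theorem mem_firstAutomaton_language_iff {w : Stream' (Letter k)} :
    w ∈ (firstAutomaton k).language ↔ topHeight w ≤ 2 * k + 1 := by
  refine (Automaton.mem_ofFun_language_iff fun _ x => by cases x <;> simp).trans ?_
  rw [topHeight_le_iff]
  refine eventually_congr (Eventually.of_forall fun n => ?_)
  cases w.get n with
  | a j => have := j.2.2; simp only [height]; simp; omega
  | _ => simp [height]

theorem mem_laterAutomaton_language_iff {i : ℕ} (hi : 1 ≤ i) (hik : i ≤ k)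
    {w : Stream' (Letter k)} :
    w ∈ (laterAutomaton k (i + 1)).language ↔ topHeight w + (2 * i + penalty i w) ≤ 2 * k + 2 := by
  rw [laterAutomaton, Automaton.mem_ofFun_language_iff (laterColor_eq (i + 1)),
    ← eventually_height_add_le_iff]
  refine eventually_congr ?_
  -- Two consecutive visits to the limit state show that the transition at `n` is a self-loop.
  filter_upwards [eventually_track_eq i w,
    (tendsto_add_atTop_nat 1).eventually (eventually_track_eq i w)] with n h1 h2
  rw [track_take_succ, h1] at h2
  change laterColor k (i + 1) (track i (w.take n)) _ = 2 ↔ _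
  rw [h1, laterColor_eq_two_iff hi hik h2, penalty]
  have h3 : ¬ i = 0 := by omega
  have h4 : ¬ k < i := by omega
  simp [h3, h4]

theorem mem_chain_language_iff {i : Fin (k + 1)} {w : Stream' (Letter k)} :
    w ∈ (chain k i).language ↔ topHeight w + (2 * i.val + penalty i.val w) ≤ 2 * k + 2 := by
  unfold chain
  split_ifs with h
  · rw [mem_firstAutomaton_language_iff, h, penalty_zero]
    omega
  · exact mem_laterAutomaton_language_iff (by omega) (by omega)

theorem chain_valid (i : Fin (k + 1)) :
    (chain k i).IsCoBuchi ∧ (chain k i).IsHistoryDeterministic := by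
  unfold chain
  split_ifs
  · exact ⟨Automaton.ofFun_isCoBuchi fun _ x => by cases x <;> simp,
      Automaton.ofFun_isHistoryDeterministic fun _ x => by cases x <;> simp⟩
  · exact ⟨Automaton.ofFun_isCoBuchi (laterColor_eq _),
      Automaton.ofFun_isHistoryDeterministic (laterColor_eq _)⟩

theorem sum_size_chain (k : ℕ) : ∑ i, (chain k i).size = 3 * k + 1 := by
  have h0 : (chain k 0).size = 1 := by
    change Nat.card Unit = 1
    simp
  have hs : ∀ i : Fin k, (chain k i.succ).size = 3 := fun i => by
    unfold chain
    rw [if_neg (by simp)]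
    change Nat.card (Fin 3) = 3
    simp
  rw [Fin.sum_univ_succ, h0]
  simp [hs]
  ring

/-! ### The color assigned by the chain -/

/-- The color that the chain assigns to a word: the number of automata accepting it. -/
noncomputable def color (w : Stream' (Letter k)) : ℕ :=
  sInf {i | 2 * k + 2 < topHeight w + (2 * i + penalty i w)}

/-- The left side of the inequality is nondecreasing in `i`: the term `2 * i` grows by `2` per step,
while the penalty varies by at most `1`. So acceptance holds on an initial segment of indices. -/
theorem lt_color_iff {i : ℕ} {w : Stream' (Letter k)} :
    i < color w ↔ topHeight w + (2 * i + penalty i w) ≤ 2 * k + 2 := by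
  constructor
  · intro h
    have := Nat.notMem_of_lt_sInf h
    exact not_lt.1 this
  · intro h
    by_contra! hc
    have hne : {i | 2 * k + 2 < topHeight w + (2 * i + penalty i w)}.Nonempty :=
      ⟨2 * k + 2, by
        change 2 * k + 2 < topHeight w + (2 * (2 * k + 2) + penalty (2 * k + 2) w)
        have : penalty (2 * k + 2) w = 1 := by simp [penalty]; omega
        omega⟩
    have h2 : 2 * k + 2 < topHeight w + (2 * color w + penalty (color w) w) := Nat.sInf_mem hne
    have h3 := penalty_le (color w) w
    rcases hc.eq_or_lt with h' | h'
    · rw [h'] at h2; omega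
    · omega

/-- The penalty `1` beyond index `k` matters here: a word ending in letters `Y_m` only has top
height `0`. -/
theorem color_le (w : Stream' (Letter k)) : color w ≤ k + 1 := by
  by_contra! h
  have := lt_color_iff.1 h
  have : penalty (k + 1) w = 1 := by simp [penalty]
  omega

theorem mem_chainLang_iff {w : Stream' (Letter k)} : w ∈ chainLang k ↔ Even (color w) := by
  have hmem : ∀ i : Fin (k + 1), w ∈ (chain k i).language ↔ i.val < color w := fun i =>
    mem_chain_language_iff.trans lt_color_iff.symm
  change ((∀ h : 0 < k + 1, w ∉ (chain k ⟨0, h⟩).language) ∨ ∃ i : Fin (k + 1),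
    w ∈ (chain k i).language ∧ (∀ j, i < j → w ∉ (chain k j).language) ∧ Even (i.val + 1)) ↔ _
  simp only [hmem, not_lt]
  have hle := color_le w
  constructor
  · rintro (h | ⟨i, h1, h2, h3⟩)
    · rw [Nat.le_zero.1 (h (by omega))]; exact Even.zero
    · have : color w = i.val + 1 := by
        by_contra hne
        have := h2 ⟨i.val + 1, by omega⟩ (Fin.lt_def.2 (by simp))
        simp at this
        omega
      rwa [this]
  · intro h
    rcases Nat.eq_zero_or_pos (color w) with h0 | h0
    · exact Or.inl fun _ => h0.le
    · refine Or.inr ⟨⟨color w - 1, by omega⟩, by simp; omega, fun j hj => ?_, ?_⟩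
      · have := Fin.lt_def.1 hj
        simp at this; omega
      · simpa [Nat.sub_add_cancel h0] using h

/-! ### The residual languages of the chain language -/

theorem laterNext_a (i : ℕ) (q : Fin 3) (j : Set.Icc 1 (2 * k + 1)) :
    laterNext k i q (.a j) = q := by
  fin_cases q <;> rfl

theorem finalState_append_const (i : ℕ) (u : List (Letter k)) (j : Set.Icc 1 (2 * k + 1)) :
    finalState i (u ++ₛ Stream'.const (.a j)) = track i u := by
  have key : ∀ n, track i ((u ++ₛ Stream'.const (.a j)).take (u.length + n)) = track i u := by
    intro n
    induction n with
    | zero => rw [add_zero, take_length_append_stream]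
    | succ n ih =>
      rw [← add_assoc, track_take_succ, ih, Stream'.get_append_right, Stream'.get_const,
        laterNext_a]
  refine finalState_eq (frequently_atTop.2 fun n => ⟨u.length + n, by omega, key n⟩)

theorem topHeight_const (x : Letter k) : topHeight (Stream'.const x) = height x := by
  refine eq_of_forall_ge_iff fun t => ?_
  simp only [topHeight_le_iff, Stream'.get_const, eventually_const]

/-- The height `2k+2-2i` meets the threshold of `A_{i+1}` exactly, so only the penalty of state `2`
decides. The two outcomes have different parity, which makes state `2` visible to the residual. -/
theorem color_append_const {i : ℕ} (hi : 1 ≤ i) (hik : i ≤ k) (u : List (Letter k)) :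
    color (u ++ₛ Stream'.const (.a ⟨2 * k + 2 - 2 * i, by simp; omega⟩)) =
      if track i u = 2 then i else i + 1 := by
  set w := u ++ₛ Stream'.const (Letter.a ⟨2 * k + 2 - 2 * i, by simp; omega⟩) with hw
  have ht : topHeight w = 2 * k + 2 - 2 * i := by
    rw [hw, topHeight_append, topHeight_const]; rfl
  have h1 := lt_color_iff (i := i - 1) (w := w)
  have h2 := lt_color_iff (i := i) (w := w)
  have h3 := lt_color_iff (i := i + 1) (w := w)
  have h4 := penalty_le (i - 1) w
  have h5 : penalty i w = if track i u = 2 then 1 else 0 := by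
    have h6 : ¬ i = 0 := by omega
    have h7 : ¬ k < i := by omega
    simp [penalty, h6, h7, hw, finalState_append_const]
  split_ifs at h5 ⊢ <;> omega

theorem track_eq_two_of_residual_eq {u u' : List (Letter k)}
    (h : residual (chainLang k) u = residual (chainLang k) u') {i : ℕ} (hi : 1 ≤ i) (hik : i ≤ k) :
    track i u = 2 ↔ track i u' = 2 := by
  have := Set.ext_iff.1 h (Stream'.const (.a ⟨2 * k + 2 - 2 * i, by simp; omega⟩))
  change _ ∈ chainLang k ↔ _ ∈ chainLang k at this
  rw [mem_chainLang_iff, mem_chainLang_iff, color_append_const hi hik,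
    color_append_const hi hik] at this
  split_ifs at this <;> grind

theorem residual_chainLang_eq_iff {u u' : List (Letter k)} :
    residual (chainLang k) u = residual (chainLang k) u' ↔
      ∀ i, 1 ≤ i → i ≤ k → track i u = track i u' := by
  constructor
  · intro h i hi hik
    have h1 := track_eq_two_of_residual_eq h hi hik
    -- Reading `X_i` moves state `1` to `2` but fixes `0`, so the test for state `2` now tells these
    -- two apart.
    have h2 : residual (chainLang k) (u ++ [.X ⟨i, hi, hik⟩]) =
        residual (chainLang k) (u' ++ [.X ⟨i, hi, hik⟩]) := by
      rw [residual_append, residual_append, h]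
    have h3 := track_eq_two_of_residual_eq h2 hi hik
    simp only [track_append, List.foldl_cons, List.foldl_nil] at h3
    generalize track i u = q at *
    generalize track i u' = q' at *
    fin_cases q <;> fin_cases q' <;> simp_all [laterNext]
  · intro h
    ext w
    change _ ∈ chainLang k ↔ _ ∈ chainLang k
    have hp : ∀ i, penalty i (u ++ₛ w) = penalty i (u' ++ₛ w) := by
      intro i
      by_cases hi : i = 0 ∨ k < i
      · rcases hi with hi | hi <;> simp [penalty, hi]
      · push Not at hi
        rw [penalty, penalty, finalState_append (h i (by omega) hi.2) w]
    rw [mem_chainLang_iff, mem_chainLang_iff, color, color, topHeight_append, topHeight_append]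
    simp only [hp]

/-! ### The effect of injections on the color -/

section

variable {J : Set ℕ} {w w' : Stream' (Letter k)}

theorem topHeight_le_of_extends (h : Extends (chainLang k) J w w') :
    topHeight w ≤ topHeight w' := by
  obtain ⟨p, hp, hget, -⟩ := h.exists_strictMono
  exact topHeight_mono hp hget

theorem finalState_eq_of_extends (h : Extends (chainLang k) J w w') {i : ℕ} (hi : 1 ≤ i)
    (hik : i ≤ k) : finalState i w' = finalState i w := by
  obtain ⟨p, hp, -, htrack⟩ := h.exists_strictMono
  have := htrack (laterNext k (i + 1)) 0 fun u v huv =>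
    residual_chainLang_eq_iff.1 huv i hi hik
  refine finalState_eq (hp.tendsto_atTop.frequently
    (p := fun n => track i (w'.take n) = finalState i w) (Eventually.frequently ?_))
  filter_upwards [eventually_track_eq i w] with n hn
  exact (this n).trans hn

theorem penalty_eq_of_extends (h : Extends (chainLang k) J w w') (i : ℕ) :
    penalty i w' = penalty i w := by
  by_cases hi : i = 0 ∨ k < i
  · rcases hi with hi | hi <;> simp [penalty, hi]
  · push Not at hi
    rw [penalty, penalty, finalState_eq_of_extends h (by omega) hi.2]

theorem color_le_of_extends (h : Extends (chainLang k) J w w') : color w' ≤ color w := by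
  refine le_of_forall_lt fun i hi => ?_
  rw [lt_color_iff, penalty_eq_of_extends h] at hi
  rw [lt_color_iff]
  have := topHeight_le_of_extends h
  omega

/-- A letter that eventually changes no state can be injected infinitely often. -/
theorem exists_extends_of_eventually (hJ : J.Infinite) {x : Letter k}
    (hx : ∀ᶠ n in atTop, ∀ i, 1 ≤ i → i ≤ k →
      laterNext k (i + 1) (track i (w.take n)) x = track i (w.take n)) :
    ∃ w', Extends (chainLang k) J w w' ∧ topHeight w' = max (topHeight w) (height x) := by
  classical
  obtain ⟨N, hN⟩ := eventually_atTop.1 hx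
  set σ : ℕ → List (Letter k) := fun j => if j ∈ J ∧ N ≤ j then [x] else [] with hσ
  have hext : Extends (chainLang k) J w (inject w σ) := by
    refine extends_inject (fun j hj => by simp [hσ, hj]) fun j => ?_
    rw [residual_chainLang_eq_iff]
    intro i hi hik
    simp only [hσ]
    split_ifs with hj
    · rw [track_append]
      exact hN (j + 1) (by omega) i hi hik
    · rw [List.append_nil]
  refine ⟨_, hext, le_antisymm ?_ (max_le (topHeight_le_of_extends hext) ?_)⟩
  · rw [topHeight_le_iff]
    refine inject_eventually (P := fun y => height y ≤ _) ?_
    filter_upwards [topHeight_le_iff.1 (le_refl (topHeight w))] with j hj y hy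
    rcases List.mem_cons.1 hy with rfl | hy
    · exact le_max_of_le_left hj
    · simp only [hσ] at hy
      split_ifs at hy
      · rw [List.mem_singleton.1 hy]; exact le_max_right _ _
      · simp at hy
  · refine height_le_topHeight (inject_frequently (frequently_atTop.2 fun n => ?_))
    obtain ⟨j, hj, hnj⟩ := hJ.exists_gt (max n N)
    exact ⟨j, by omega, by simp only [hσ]; rw [if_pos ⟨hj, by omega⟩]⟩

/-- Injecting a suitable letter `a_j` lowers the color by one. -/
theorem exists_extends_color_add_one (hJ : J.Infinite) (hw : 2 ≤ color w) :
    ∃ w', Extends (chainLang k) J w w' ∧ color w' + 1 = color w := by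
  have hle := color_le w
  obtain ⟨w', hext, ht⟩ := exists_extends_of_eventually (w := w) hJ
    -- With `c = color w`, acceptance at index `c - 1` bounds the old top height by `2k+4-2c`, so
    -- the injected letter sets the new one. It breaks the threshold at index `c - 1` but meets that
    -- at `c - 2` even with penalty `1`. For `c ≥ 2` such a letter exists.
    (x := .a ⟨2 * k + 5 - 2 * color w, by simp; omega⟩)
    (Eventually.of_forall fun n i _ _ => laterNext_a _ _ _)
  refine ⟨w', hext, ?_⟩
  simp only [height] at ht
  have h1 := (lt_color_iff (i := color w - 1) (w := w)).1 (by omega)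
  have h2 := lt_color_iff (i := color w - 2) (w := w')
  have h3 := lt_color_iff (i := color w - 1) (w := w')
  have h4 := penalty_le (color w - 2) w'
  omega

end

/-! ### The chain computes the natural colors -/

theorem atHome_color (w : Stream' (Letter k)) : AtHome (chainLang k) (color w) w := by
  induction hc : color w using Nat.strong_induction_on generalizing w with
  | _ c ih =>
    rw [AtHome]
    refine ⟨Set.univ, Set.infinite_univ, fun w' hw' => ?_⟩
    have hle := color_le_of_extends hw'
    rcases hle.lt_or_eq with h | h
    · exact Or.inl ⟨⟨color w', hc ▸ h⟩, ih _ (hc ▸ h) w' rfl⟩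
    · right
      rw [mem_chainLang_iff, mem_chainLang_iff, h, hc, Nat.not_even_iff_odd]
      rcases Nat.even_or_odd c with h' | h'
      · exact Or.inl ⟨h', h', h'⟩
      · exact Or.inr ⟨h', h', h'⟩

/-- Every `J` admits an extension of color at least `i` and of parity opposite to `i`: the word
itself, or, if its color has the parity of `i` and hence is at least `i + 2`, an extension of color
one less. Parity excludes the membership clauses, induction the smaller colors. -/
theorem not_atHome_of_lt_color {i : ℕ} {w : Stream' (Letter k)} (h : i < color w) :
    ¬ AtHome (chainLang k) i w := by
  induction i using Nat.strong_induction_on generalizing w with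
  | _ i ih =>
    rw [AtHome]
    rintro ⟨J, hJ, H⟩
    obtain ⟨w', hext, hlt, hpar⟩ : ∃ w', Extends (chainLang k) J w w' ∧ i ≤ color w' ∧
        (Even (color w') ↔ ¬ Even i) := by
      by_cases hp : Even (color w) ↔ Even i
      · have hne : color w ≠ i + 1 := fun h' => by
          rw [h', Nat.even_add_one] at hp; tauto
        obtain ⟨w', hext, hc⟩ := exists_extends_color_add_one (w := w) hJ (by omega)
        rw [← hc, Nat.even_add_one] at hp
        exact ⟨w', hext, by omega, by tauto⟩
      · exact ⟨w, extends_refl _ _ _, h.le, by tauto⟩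
    rcases H w' hext with ⟨j, hj⟩ | ⟨-, hm, he⟩ | ⟨-, hm, ho⟩
    · exact ih j j.2 (by omega) hj
    · rw [mem_chainLang_iff] at hm; tauto
    · rw [mem_chainLang_iff] at hm
      rw [← Nat.not_even_iff_odd] at ho; tauto

theorem isNaturalColor_color (w : Stream' (Letter k)) :
    IsNaturalColor (chainLang k) w (color w) :=
  ⟨atHome_color w, fun _ hi => not_lt.1 fun h => not_atHome_of_lt_color h hi⟩

theorem isCOCOA_chain (k : ℕ) : IsCOCOA (chainLang k) (chain k) :=
  ⟨chain_valid, fun w => ⟨color w, isNaturalColor_color w, color_le w, fun _ =>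
    mem_chain_language_iff.trans lt_color_iff.symm⟩⟩

theorem strictAnti_chain_language (k : ℕ) : StrictAnti fun i => (chain k i).language := by
  intro i j hij
  have hij' := Fin.lt_def.1 hij
  have hj := j.2
  have hmem : ∀ {l : Fin (k + 1)} {w}, w ∈ (chain k l).language ↔ l.val < color w :=
    mem_chain_language_iff.trans lt_color_iff.symm
  refine ⟨fun w hw => hmem.2 (hij'.trans (hmem.1 hw)), fun hsub => ?_⟩
  -- A word of color exactly `i + 1`: it passes at index `i` under either penalty and fails at `i +
  -- 1` under either.
  let w : Stream' (Letter k) := Stream'.const (.a ⟨2 * k + 1 - 2 * i.val, by simp; omega⟩)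
  have ht : topHeight w = 2 * k + 1 - 2 * i.val := topHeight_const _
  have h2 := lt_color_iff (i := i.val) (w := w)
  have h3 := lt_color_iff (i := i.val + 1) (w := w)
  have h4 := penalty_le i.val w
  have h5 := hmem.1 (hsub (hmem.2 (h2.2 (by omega))))
  omega

/-! ### Natural color zero for the complement -/

theorem mem_complZero_iff_forall {w : Stream' (Letter k)} :
    w ∈ complZero k ↔ ∃ J : Set ℕ, J.Infinite ∧ ∀ w', Extends (chainLang k) J w w' →
      ¬ Even (color w') := by
  have h0 : w ∈ complZero k ↔ AtHome (chainLang k)ᶜ 0 w :=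
    ⟨fun h => h.1, fun h => ⟨h, fun _ _ => Nat.zero_le _⟩⟩
  rw [h0, AtHome]
  simp only [extends_compl_iff, Set.mem_compl_iff, mem_chainLang_iff]
  refine exists_congr fun J => and_congr_right fun hJ => ⟨fun H w' hw' => ?_, fun H w' hw' => ?_⟩
  · rcases H w' hw' with ⟨j, -⟩ | ⟨-, h, -⟩ | ⟨-, -, h⟩
    · exact j.elim0
    · exact h
    · simp at h
  · exact Or.inr (Or.inl ⟨H w (extends_refl _ _ _), H w' hw', Even.zero⟩)

/-- An `X_m` read in state `1` would move the automaton on to state `2`, so no `X_m` occurs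
infinitely often. -/
theorem topHeight_le_of_finalState_eq_one {w : Stream' (Letter k)}
    (h : ∀ i, 1 ≤ i → i ≤ k → finalState i w = 1) : topHeight w ≤ 2 * k + 1 := by
  rw [topHeight_le_iff]
  have h1 : ∀ m : Set.Icc 1 k, ∀ᶠ n in atTop, w.get n ≠ .X m := by
    intro m
    filter_upwards [eventually_track_eq m.val w] with n hn hX
    have h2 := track_le_finalState m.val (n + 1) w
    rw [track_take_succ, hn, h m.val m.2.1 m.2.2, hX] at h2
    simp [laterNext] at h2
  filter_upwards [eventually_all.2 h1] with n hn
  generalize w.get n = x at *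
  cases x with
  | a j => exact j.2.2
  | X m => exact absurd rfl (hn m)
  | Y m => exact Nat.zero_le _

theorem mem_complZero_iff {w : Stream' (Letter k)} :
    w ∈ complZero k ↔ (∀ i, 1 ≤ i → i ≤ k → finalState i w = 1) ∧ topHeight w = 2 * k + 1 := by
  rw [mem_complZero_iff_forall]
  constructor
  · rintro ⟨J, hJ, H⟩
    have h1 : ∀ i, 1 ≤ i → i ≤ k → finalState i w = 1 := by
      intro i hi hik
      by_contra hne
      -- `X_i` changes a state only from state `1` of the automaton with parameter `i`, which by
      -- assumption is not its limit. Injecting it forever gives color `0`.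
      obtain ⟨w', hext, ht⟩ := exists_extends_of_eventually (w := w) hJ
        (x := .X ⟨i, hi, hik⟩) (by
          filter_upwards [eventually_track_eq i w] with n hn l _ _
          by_cases hl : l = i
          · subst hl
            rw [hn]
            generalize finalState l w = q at *
            fin_cases q <;> simp [laterNext] at hne ⊢
          · generalize track l (w.take n) = q
            fin_cases q <;> simp [laterNext, Ne.symm hl])
      have hc := lt_color_iff (i := 0) (w := w')
      rw [penalty_zero, ht] at hc
      simp only [height] at hc
      refine H w' hext ?_
      rw [show color w' = 0 by omega]
      exact Even.zero
    refine ⟨h1, ?_⟩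
    have htop := topHeight_le_of_finalState_eq_one h1
    by_contra hne
    have hw := H w (extends_refl _ _ _)
    -- For `k ≥ 1` a top height of at most `2k` passes at index `1`, where the penalty is `0`. For
    -- `k = 0` the only letter is `a_1`, so the top height cannot be `0`.
    have hc : 2 ≤ color w := by
      have h0 := lt_color_iff (i := 0) (w := w)
      rw [penalty_zero] at h0
      have : color w ≠ 0 := by omega
      have h2 : color w ≠ 1 := by
        intro h'
        have h3 := lt_color_iff (i := 1) (w := w)
        rw [h'] at h3
        by_cases hk : 1 ≤ k
        · have : penalty 1 w = 0 := by simp [penalty, h1 1 le_rfl hk]; omega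
          omega
        · have : topHeight w = 0 := by omega
          have : ∀ᶠ n in atTop, height (w.get n) ≤ 0 := topHeight_le_iff.1 this.le
          obtain ⟨n, hn⟩ := this.exists
          generalize w.get n = x at hn
          cases x with
          | a j => have := j.2.1; simp [height] at hn; omega
          | X m => have := m.2.1.trans m.2.2; omega
          | Y m => have := m.2.1.trans m.2.2; omega
      omega
    obtain ⟨w', hext, hc'⟩ := exists_extends_color_add_one hJ hc
    have := H w' hext
    rw [← hc', Nat.even_add_one] at hw
    tauto
  · rintro ⟨h1, ht⟩
    refine ⟨Set.univ, Set.infinite_univ, fun w' hext => ?_⟩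
    have h2 := topHeight_le_of_extends hext
    have h3 := topHeight_le_of_finalState_eq_one (w := w') fun i hi hik =>
      (finalState_eq_of_extends hext hi hik).trans (h1 i hi hik)
    have h4 := lt_color_iff (i := 0) (w := w')
    have h5 := lt_color_iff (i := 1) (w := w')
    rw [penalty_zero] at h4
    -- Top height `2k+1` passes at index `0` and fails at index `1` under either penalty.
    rw [show color w' = 1 by omega]
    simp

theorem finalState_eq_one_iff {w : Stream' (Letter k)} (m : Set.Icc 1 k) :
    finalState m.val w = 1 ↔ ∃ j : ℕ, (∀ l < j, w.get l ≠ .Y m) ∧ w.get j = .Y m ∧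
      ∀ l > j, w.get l ≠ .X m := by
  classical
  have hzero : ∀ j, (∀ l < j, w.get l ≠ .Y m) → track m.val (w.take j) = 0 := by
    intro j
    induction j with
    | zero => intro _; rfl
    | succ j ih =>
      intro h
      have hj := h j (by omega)
      rw [track_take_succ, ih fun l hl => h l (by omega)]
      generalize w.get j = x at hj
      cases x with
      | Y m' =>
        have : m'.val ≠ m.val := fun h' => hj (congrArg _ (Subtype.ext h'))
        simp [laterNext, this]
      | _ => rfl
  have hone : ∀ j, (∀ l < j, w.get l ≠ .Y m) → w.get j = .Y m →
      track m.val (w.take (j + 1)) = 1 := by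
    intro j h hj
    rw [track_take_succ, hzero j h, hj]
    simp [laterNext]
  constructor
  · intro h
    have hex : ∃ j, w.get j = .Y m := by
      by_contra! hno
      have := finalState_eq (i := m.val) (w := w) (q := 0)
        (Frequently.of_forall fun n => hzero n fun l _ => hno l)
      rw [this] at h
      simp at h
    refine ⟨Nat.find hex, fun l hl => Nat.find_min hex hl, Nat.find_spec hex, fun l hl hX => ?_⟩
    have h1 := hone _ (fun l hl => Nat.find_min hex hl) (Nat.find_spec hex)
    have h2 : 1 ≤ track m.val (w.take l) := h1 ▸ track_monotone m.val w hl
    have h3 := track_le_finalState m.val (l + 1) w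
    rw [track_take_succ, h, hX] at h3
    generalize track m.val (w.take l) = q at *
    fin_cases q <;> simp [laterNext] at h2 h3
  · rintro ⟨j, h1, h2, h3⟩
    refine finalState_eq (Eventually.frequently (eventually_atTop.2 ⟨j + 1, fun n hn => ?_⟩))
    induction n, hn using Nat.le_induction with
    | base => exact hone j h1 h2
    | succ n hn ih =>
      have hX := h3 n (by omega)
      rw [track_take_succ, ih]
      generalize w.get n = x at hX
      cases x with
      | X m' =>
        have : m'.val ≠ m.val := fun h' => hX (congrArg _ (Subtype.ext h'))
        simp [laterNext, this]
      | _ => rfl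

theorem mem_complZero_iff_occurrences {w : Stream' (Letter k)} : w ∈ complZero k ↔
    (∀ m : Set.Icc 1 k, ∃ j : ℕ, (∀ l < j, w.get l ≠ .Y m) ∧ w.get j = .Y m ∧
      ∀ l > j, w.get l ≠ .X m) ∧
    ∃ᶠ j in atTop, w.get j = .a ⟨2 * k + 1, by simp⟩ := by
  simp only [← finalState_eq_one_iff]
  rw [mem_complZero_iff]
  have h0 : (∀ m : Set.Icc 1 k, finalState m.val w = 1) ↔
      ∀ i, 1 ≤ i → i ≤ k → finalState i w = 1 :=
    ⟨fun h i hi hik => h ⟨i, hi, hik⟩, fun h m => h _ m.2.1 m.2.2⟩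
  rw [h0]
  refine and_congr_right fun h => ⟨fun ht => ?_, fun hf => ?_⟩
  · by_contra hf
    rw [not_frequently] at hf
    have : topHeight w ≤ 2 * k := by
      rw [topHeight_le_iff]
      filter_upwards [hf, topHeight_le_iff.1 ht.le] with n hn hle
      generalize w.get n = x at *
      cases x with
      | a j =>
        have : j.val ≠ 2 * k + 1 := fun h' => hn (congrArg _ (Subtype.ext h'))
        simp only [height] at hle ⊢
        omega
      | X m => simp [height] at hle
      | Y m => exact Nat.zero_le _
    omega
  · exact le_antisymm (topHeight_le_of_finalState_eq_one h) (height_le_topHeight hf)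

/-! ### Lower bounds from the sets of letters `Y_m` already read -/

/-- The finite word that lists the letters `Y_m` for `m ∈ S`. -/
noncomputable def yWord (S : Finset (Set.Icc 1 k)) : List (Letter k) :=
  S.toList.map .Y

theorem track_map_Y (m : Set.Icc 1 k) (l : List (Set.Icc 1 k)) :
    track m.val (l.map .Y) = if m ∈ l then 1 else 0 := by
  induction l using List.reverseRecOn with
  | nil => rfl
  | append_singleton l x ih =>
    rw [List.map_append, track_append, ih]
    simp only [List.map_cons, List.map_nil, List.foldl_cons, List.foldl_nil, List.mem_append,
      List.mem_singleton]
    by_cases hm : m ∈ l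
    · simp [hm, laterNext]
    · simp only [hm, if_false, false_or, laterNext]
      simp [Subtype.ext_iff, eq_comm]

theorem yWord_append_mem_complZero_iff {S T : Finset (Set.Icc 1 k)} :
    yWord S ++ₛ (yWord T ++ₛ Stream'.const (.a ⟨2 * k + 1, by simp⟩)) ∈ complZero k ↔
      ∀ m, m ∈ S ∨ m ∈ T := by
  rw [← Stream'.append_append_stream, mem_complZero_iff, topHeight_append, topHeight_const,
    and_iff_left (by rfl)]
  simp only [finalState_append_const, yWord, ← List.map_append]
  constructor
  · intro h m
    have := h m.val m.2.1 m.2.2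
    rw [track_map_Y] at this
    simpa [or_iff_not_imp_left] using this
  · intro h i hi hik
    rw [track_map_Y ⟨i, hi, hik⟩, if_pos]
    simpa using h ⟨i, hi, hik⟩

theorem residual_complZero_yWord_injective (k : ℕ) :
    Function.Injective fun S : Finset (Set.Icc 1 k) => residual (complZero k) (yWord S) := by
  classical
  have key : ∀ S T : Finset (Set.Icc 1 k),
      residual (complZero k) (yWord S) = residual (complZero k) (yWord T) → S ⊆ T := by
    intro S T h m hm
    -- The continuation supplies every `Y` except `Y_m`, so membership tests whether `Y_m` was read
    -- before.
    have h1 : yWord (Finset.univ.erase m) ++ₛ Stream'.const (.a ⟨2 * k + 1, by simp⟩) ∈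
        residual (complZero k) (yWord S) :=
      yWord_append_mem_complZero_iff.2 fun m' => by
        by_cases h' : m' = m
        · exact Or.inl (h' ▸ hm)
        · exact Or.inr (by simp [h'])
    rw [h] at h1
    simpa using yWord_append_mem_complZero_iff.1 h1 m
  exact fun S T h => (key S T h).antisymm (key T S h.symm)

theorem card_finset_Icc (k : ℕ) : Fintype.card (Finset (Set.Icc 1 k)) = 2 ^ k := by
  simp

theorem two_pow_le_encard_residual (k : ℕ) :
    (2 ^ k : ℕ∞) ≤ (Set.range (residual (complZero k))).encard := by
  have h1 : Set.range (fun S : Finset (Set.Icc 1 k) => residual (complZero k) (yWord S)) ⊆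
      Set.range (residual (complZero k)) := by
    rintro _ ⟨S, rfl⟩
    exact ⟨_, rfl⟩
  refine le_trans (le_of_eq ?_) (Set.encard_le_encard h1)
  rw [← Set.image_univ, (residual_complZero_yWord_injective k).encard_image, Set.encard_univ,
    ENat.card_eq_coe_fintype_card, card_finset_Icc]
  simp

theorem const_a_notMem_complZero (hk : 1 ≤ k) (u : List (Letter k)) :
    u ++ₛ Stream'.const (.a ⟨1, by simp⟩) ∉ complZero k := by
  rw [mem_complZero_iff, topHeight_append, topHeight_const]
  rintro ⟨-, h⟩
  simp only [height] at h
  omega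

theorem pos_of_isCOCOA_compl (hk : 1 ≤ k) {n : ℕ} {C : Fin n → Automaton.{0, v} (Letter k)}
    (hC : IsCOCOA (chainLang k)ᶜ C) : 0 < n := by
  obtain ⟨c, hc, hn, -⟩ := hC.2 (Stream'.const (.a ⟨1, by simp⟩))
  refine Nat.pos_of_ne_zero fun h0 => const_a_notMem_complZero hk [] ?_
  have : c = 0 := by omega
  subst this
  exact hc

theorem language_eq_compl_complZero {n : ℕ} {C : Fin n → Automaton.{0, v} (Letter k)}
    (hC : IsCOCOA (chainLang k)ᶜ C) (h : 0 < n) : (C ⟨0, h⟩).language = (complZero k)ᶜ := by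
  ext w
  obtain ⟨c, hc, hn, hi⟩ := hC.2 w
  have h0 : w ∈ complZero k ↔ c = 0 :=
    ⟨fun h' => IsLeast.unique hc h', fun h' => by subst h'; exact hc⟩
  rw [hi, Set.mem_compl_iff, h0]
  simp
  omega

theorem two_pow_le_size {n : ℕ} {C : Fin n → Automaton.{0, v} (Letter k)}
    (hC : IsCOCOA (chainLang k)ᶜ C) (h : 0 < n) : 2 ^ k ≤ (C ⟨0, h⟩).size := by
  have hlang := language_eq_compl_complZero hC h
  obtain ⟨f, hf⟩ := (hC.1 ⟨0, h⟩).2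
  have := (C ⟨0, h⟩).finite_state
  -- For `k = 0` the first automaton accepts nothing, so no residual is nonempty; the initial state
  -- alone gives the bound.
  rcases Nat.eq_zero_or_pos k with rfl | hk
  · have : Nonempty (C ⟨0, h⟩).State := ⟨(C ⟨0, h⟩).init⟩
    exact Nat.card_pos
  -- The advised run starts in `init`, not in `f []`; a neutral first letter makes all the words
  -- nonempty. Its constant word also witnesses that all residuals are nonempty.
  let x : Letter k := .a ⟨1, by simp⟩
  have hx : ∀ S : Finset (Set.Icc 1 k),
      residual (complZero k) (x :: yWord S) = residual (complZero k) (yWord S) := by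
    intro S
    ext w
    change _ ∈ complZero k ↔ _ ∈ complZero k
    have htr : ∀ i, track i (x :: yWord S) = track i (yWord S) := fun i => rfl
    rw [mem_complZero_iff, mem_complZero_iff, topHeight_append, topHeight_append]
    simp only [finalState_append (htr _) w]
  have hne : ∀ u, (residual (C ⟨0, h⟩).language u).Nonempty := fun u =>
    ⟨Stream'.const x, by rw [hlang]; exact const_a_notMem_complZero hk u⟩
  have hinj : Function.Injective fun S : Finset (Set.Icc 1 k) => f (x :: yWord S) := by
    intro S T hST
    apply residual_complZero_yWord_injective k
    have h1 := (Automaton.residual_eq_of_advice_eq hf (by simp) (by simp) (hne _) hST).antisymm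
      (Automaton.residual_eq_of_advice_eq hf (by simp) (by simp) (hne _) hST.symm)
    rw [hlang, residual_compl_eq_iff, hx, hx] at h1
    exact h1
  have := Nat.card_le_card_of_injective _ hinj
  rwa [Nat.card_eq_fintype_card, card_finset_Icc] at this

end Cocoa

theorem mainTheorem2 (k : ℕ) :
    -- the chain has `3k + 1` states in total, falls strictly, and is a valid COCOA
    (∑ i, (Cocoa.chain k i).size = 3 * k + 1) ∧
    StrictAnti (fun i => (Cocoa.chain k i).language) ∧
    Cocoa.IsCOCOA (Cocoa.chainLang k) (Cocoa.chain k) ∧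
    -- the words of natural color `0` with respect to the complement
    (∀ w : Stream' (Cocoa.Letter k), w ∈ Cocoa.complZero k ↔
      (∀ m : Set.Icc 1 k, ∃ j : ℕ, (∀ l < j, w.get l ≠ .Y m) ∧ w.get j = .Y m ∧
        ∀ l > j, w.get l ≠ .X m) ∧
      ∃ᶠ j in Filter.atTop, w.get j = .a ⟨2 * k + 1, by simp⟩) ∧
    -- they form a language with at least `2^k` residual languages
    (2 ^ k : ℕ∞) ≤ (Set.range (Cocoa.residual (Cocoa.complZero k))).encard ∧
    -- the first element of every COCOA for the complement has at least `2^k` states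
    (∀ (n : ℕ) (C : Fin n → Cocoa.Automaton.{0, v} (Cocoa.Letter k)),
      Cocoa.IsCOCOA (Cocoa.chainLang k)ᶜ C →
        (1 ≤ k → 0 < n) ∧ ∀ h : 0 < n, 2 ^ k ≤ (C ⟨0, h⟩).size) :=
  ⟨Cocoa.sum_size_chain k, Cocoa.strictAnti_chain_language k, Cocoa.isCOCOA_chain k,
    fun _ => Cocoa.mem_complZero_iff_occurrences, Cocoa.two_pow_le_encard_residual k,
    fun _ _ hC => ⟨fun hk => Cocoa.pos_of_isCOCOA_compl hk hC,
      fun h => Cocoa.two_pow_le_size hC h⟩⟩
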